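/- Let $T$ be a complete first-order theory, and let formulas be formulas of its language without parameters. For $n\in\omega$, an $n$-formula of $T$ is a formula $\varphi(\overline x)$ that is $T$-equivalent to a Boolean combination of formulas each of which has at most $n$ free variables. The theory $T$ is $n$-ary, for $n\neq 1$, if every formula is an $n$-formula of $T$; it is $1$-ary (unary) if every formula is $T$-equivalent to a Boolean combination of formulas with at most one free variable and of formulas $x\approx y$. The theory $T$ is almost $n$-ary if there are finitely many formulas $\varphi_1(\overline x),\ldots,\varphi_s(\overline x)$ such that every formula is $T$-equivalent to a Boolean combination of $n$-formulas of $T$ and of formulas obtained from $\varphi_1,\ldots,\varphi_s$ by substituting variables for the free variables. Let $\mathrm{ar}(T)$ be the least $n\in\omega$ such that $T$ is $n$-ary, and $\mathrm{aar}(T)$ the least $n\in\omega$ such that $T$ is almost $n$-ary (the value is $\infty$ if there is no such $n$). Theorem. For all positive integers $m\leq n$ there is a complete first-order theory $T_{mn}$ with $\mathrm{aar}(T_{mn})=m$ and $\mathrm{ar}(T_{mn})=n$. -/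

import Mathlib

namespace ArityOfTheories

open FirstOrder FirstOrder.Language

universe u v w

variable {L : FirstOrder.Language.{u, v}}

/-- `IsBoolComb Δ φ`: the formula `φ` is a (finite) Boolean combination of formulas in `Δ`. -/
inductive IsBoolComb {α : Type w} (Δ : Set (L.Formula α)) : L.Formula α → Prop
  | of {φ : L.Formula α} (h : φ ∈ Δ) : IsBoolComb Δ φ
  | bot : IsBoolComb Δ ⊥
  | not {φ : L.Formula α} (h : IsBoolComb Δ φ) : IsBoolComb Δ φ.not
  | inf {φ ψ : L.Formula α} (h₁ : IsBoolComb Δ φ) (h₂ : IsBoolComb Δ ψ) : IsBoolComb Δ (φ ⊓ ψ)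
  | sup {φ ψ : L.Formula α} (h₁ : IsBoolComb Δ φ) (h₂ : IsBoolComb Δ ψ) : IsBoolComb Δ (φ ⊔ ψ)

/-- `φ` is `T`-equivalent to a Boolean combination of formulas in `Δ`. -/
def IsBasedOn {α : Type w} (T : L.Theory) (Δ : Set (L.Formula α)) (φ : L.Formula α) : Prop :=
  ∃ ψ : L.Formula α, IsBoolComb Δ ψ ∧ (φ ⇔[T] ψ)

/-- The formulas in the variables `x₀, …, x_{k-1}` with at most `n` free variables. (With dummy
variables such as in `x = x` any of them can be regarded as a formula of `n` free variables.) -/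
def formulasOfArity (L : FirstOrder.Language.{u, v}) (n k : ℕ) : Set (L.Formula (Fin k)) :=
  {φ | φ.freeVarFinset.card ≤ n}

/-- The formulas `xᵢ = xⱼ` in the variables `x₀, …, x_{k-1}`. -/
def equalities (L : FirstOrder.Language.{u, v}) (k : ℕ) : Set (L.Formula (Fin k)) :=
  {φ | ∃ i j : Fin k, φ = (Term.var i).equal (Term.var j)}

/-- `φ` is an `n`-formula of `T`: it is `T`-equivalent to a Boolean combination of formulas with
`n` free variables. For `n = 0` this means that `φ` is `T`-equivalent to a sentence. -/
def IsNFormula (T : L.Theory) (n : ℕ) {k : ℕ} (φ : L.Formula (Fin k)) : Prop :=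
  IsBasedOn T (formulasOfArity L n k) φ

/-- `T` is unary: every formula is `T`-equivalent to a Boolean combination of formulas with one
free variable and of equalities between variables. -/
def IsUnary (T : L.Theory) : Prop :=
  ∀ (k : ℕ) (φ : L.Formula (Fin k)), IsBasedOn T (formulasOfArity L 1 k ∪ equalities L k) φ

/-- `T` is `n`-ary. For `n = 1` this means unary (so that equalities are admitted); for every other
`n` it means that every formula is an `n`-formula of `T`. -/
def IsNAry (T : L.Theory) (n : ℕ) : Prop :=
  if n = 1 then IsUnary T else ∀ (k : ℕ) (φ : L.Formula (Fin k)), IsNFormula T n φ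

/-- The formulas in the variables `x₀, …, x_{k-1}` obtained from the formulas in `Φ` by
substituting variables for the free variables (distinct variables may be identified). -/
def substitutions {r : ℕ} (Φ : Set (L.Formula (Fin r))) (k : ℕ) : Set (L.Formula (Fin k)) :=
  {χ | ∃ φ ∈ Φ, ∃ f : Fin r → Fin k, χ = φ.relabel f}

/-- `T` is almost `n`-ary: for some finite set `Φ` of formulas, in a common tuple of variables,
every formula is `T`-equivalent to a Boolean combination of `n`-formulas and of formulas obtained
from those in `Φ` by substitution of variables. -/
def IsAlmostNAry (T : L.Theory) (n : ℕ) : Prop :=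
  ∃ (r : ℕ) (Φ : Set (L.Formula (Fin r))), Φ.Finite ∧
    ∀ (k : ℕ) (φ : L.Formula (Fin k)),
      IsBasedOn T ({ψ : L.Formula (Fin k) | IsNFormula T n ψ} ∪ substitutions Φ k) φ

/-- The arity of `T`: the least `n` such that `T` is `n`-ary, and `∞` if there is none. -/
noncomputable def ar (T : L.Theory) : ℕ∞ :=
  sInf {N : ℕ∞ | ∃ n : ℕ, IsNAry T n ∧ N = n}

/-- The almost arity of `T`: the least `n` such that `T` is almost `n`-ary, and `∞` if there is
none. -/
noncomputable def aar (T : L.Theory) : ℕ∞ :=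
  sInf {N : ℕ∞ | ∃ n : ℕ, IsAlmostNAry T n ∧ N = n}

end ArityOfTheories

/-!
Points of the structure come in columns of two, one of each parity, and for each `i` there are
`d i` columns. The language names the columns, and for each `i` it has a `d i`-ary relation saying
that a tuple runs through the columns of index `i` in order and has even total parity. Shifting
parities by amounts that sum to zero over the columns of each index is an automorphism, and a tuple
that misses some column of index `i` carries no information on the total parity. The first fact
yields quantifier elimination. The second one shows that the `i`-th relation is not a Boolean
combination of formulas with fewer than `d i` variables, not even with the help of finitely many
formulas, unless these mention a symbol of index `i`. So the arity is the maximum of `d`, and the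
almost arity is the largest value that `d` attains or exceeds infinitely often; it remains to let
`d` take the value `n` once and the value `m` infinitely often.
-/

namespace ArityOfTheories

open FirstOrder FirstOrder.Language FirstOrder.Language.Structure

universe u v w x

section BooleanCombinations

variable {L : FirstOrder.Language.{u, v}} {α : Type w} {T : L.Theory} {Δ Γ : Set (L.Formula α)}
  {φ ψ : L.Formula α}

theorem IsBoolComb.iSup {β : Type*} [Finite β] {f : β → L.Formula α}
    (hf : ∀ b, IsBoolComb Δ (f b)) : IsBoolComb Δ (Formula.iSup f) := by
  suffices ∀ l : List β, IsBoolComb Δ ((l.map f).foldr (· ⊔ ·) ⊥) from this _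
  intro l
  induction l with
  | nil => exact .bot
  | cons b l ih => exact .sup (hf b) ih

theorem IsBoolComb.iInf {β : Type*} [Finite β] {f : β → L.Formula α}
    (hf : ∀ b, IsBoolComb Δ (f b)) : IsBoolComb Δ (Formula.iInf f) := by
  suffices ∀ l : List β, IsBoolComb Δ ((l.map f).foldr (· ⊓ ·) ⊤) from this _
  intro l
  induction l with
  | nil => exact .not .bot
  | cons b l ih => exact .inf (hf b) ih

theorem IsBasedOn.of_mem (h : φ ∈ Δ) : IsBasedOn T Δ φ :=
  ⟨φ, .of h, .refl φ⟩

theorem IsBasedOn.trans (h : IsBasedOn T Δ φ) (hΔ : ∀ δ ∈ Δ, IsBasedOn T Γ δ) :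
    IsBasedOn T Γ φ := by
  obtain ⟨ψ, hψ, hφψ⟩ := h
  suffices IsBasedOn T Γ ψ by
    obtain ⟨χ, hχ, hψχ⟩ := this
    exact ⟨χ, hχ, hφψ.trans hψχ⟩
  clear hφψ
  induction hψ with
  | of h => exact hΔ _ h
  | bot => exact ⟨⊥, .bot, .refl ⊥⟩
  | not _ ih =>
    obtain ⟨χ, hχ, h⟩ := ih
    exact ⟨χ.not, .not hχ, h.not⟩
  | inf _ _ ih₁ ih₂ =>
    obtain ⟨χ₁, hχ₁, h₁⟩ := ih₁
    obtain ⟨χ₂, hχ₂, h₂⟩ := ih₂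
    exact ⟨χ₁ ⊓ χ₂, .inf hχ₁ hχ₂, (h₁.imp h₂.not).not⟩
  | sup _ _ ih₁ ih₂ =>
    obtain ⟨χ₁, hχ₁, h₁⟩ := ih₁
    obtain ⟨χ₂, hχ₂, h₂⟩ := ih₂
    exact ⟨χ₁ ⊔ χ₂, .sup hχ₁ hχ₂, h₁.not.imp h₂⟩

theorem IsBasedOn.mono (h : IsBasedOn T Δ φ) (hΔ : Δ ⊆ Γ) : IsBasedOn T Γ φ :=
  h.trans fun _ hδ => .of_mem (hΔ hδ)

variable {M : Type x} [L.Structure M]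

/-- No formula of `Δ` separates the tuples `v` and `w`. -/
def AgreeOn (Δ : Set (L.Formula α)) (v w : α → M) : Prop :=
  ∀ δ ∈ Δ, δ.Realize v ↔ δ.Realize w

theorem AgreeOn.union {v w : α → M} (hΔ : AgreeOn Δ v w) (hΓ : AgreeOn Γ v w) :
    AgreeOn (Δ ∪ Γ) v w :=
  fun δ hδ => hδ.elim (hΔ δ) (hΓ δ)

theorem AgreeOn.realize_iff_of_isBoolComb {v w : α → M} (h : AgreeOn Δ v w)
    (hψ : IsBoolComb Δ ψ) : ψ.Realize v ↔ ψ.Realize w := by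
  induction hψ with
  | of hδ => exact h _ hδ
  | bot => exact Iff.rfl
  | not _ ih => exact not_congr ih
  | inf _ _ ih₁ ih₂ => simp only [Formula.realize_inf, ih₁, ih₂]
  | sup _ _ ih₁ ih₂ => simp only [Formula.realize_sup, ih₁, ih₂]

theorem AgreeOn.realize_iff_of_isBasedOn [M ⊨ T] [Nonempty M] {v w : α → M} (h : AgreeOn Δ v w)
    (hφ : IsBasedOn T Δ φ) : φ.Realize v ↔ φ.Realize w := by
  obtain ⟨ψ, hψ, hφψ⟩ := hφ
  rw [hφψ.realize_iff, h.realize_iff_of_isBoolComb hψ, hφψ.realize_iff]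

/-- The universal closure of a formula. -/
noncomputable def allClosure [Finite α] (φ : L.Formula α) : L.Sentence :=
  Formula.iAlls α (φ.relabel (Sum.inr : α → Empty ⊕ α))

theorem realize_allClosure [Finite α] : M ⊨ allClosure φ ↔ ∀ v : α → M, φ.Realize v := by
  simp [allClosure, Sentence.Realize, Formula.realize_iAlls, Function.comp_def]

theorem iff_completeTheory_of_forall_realize_iff [Finite α]
    (h : ∀ v : α → M, φ.Realize v ↔ ψ.Realize v) : φ ⇔[L.completeTheory M] ψ := by
  have hM : M ⊨ allClosure (φ.iff ψ) :=
    realize_allClosure.2 fun v => Formula.realize_iff.2 (h v)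
  exact Theory.models_formula_iff.2 fun N =>
    realize_allClosure.1 ((realize_iff_of_model_completeTheory M N _).2 hM)

theorem isBasedOn_completeTheory_of_finite [Finite α] (hΔ : Δ.Finite)
    (h : ∀ v w : α → M, AgreeOn Δ v w → φ.Realize v → φ.Realize w) :
    IsBasedOn (L.completeTheory M) Δ φ := by
  classical
  have := hΔ.to_subtype
  let signs (v : α → M) : Set Δ := {δ | δ.1.Realize v}
  let cell (P : Set Δ) : L.Formula α := Formula.iInf fun δ : Δ => if δ ∈ P then δ.1 else δ.1.not
  have realize_cell (P : Set Δ) (w : α → M) : (cell P).Realize w ↔ P = signs w := by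
    rw [Formula.realize_iInf, Set.ext_iff]
    refine forall_congr' fun δ => ?_
    by_cases hδ : δ ∈ P <;> simp [hδ, signs]
  have isBoolComb_cell (P : Set Δ) : IsBoolComb Δ (cell P) := by
    refine .iInf fun δ => ?_
    split_ifs
    exacts [.of δ.2, .not (.of δ.2)]
  refine ⟨Formula.iSup fun P : signs '' {v | φ.Realize v} => cell P,
    .iSup fun P => isBoolComb_cell P, iff_completeTheory_of_forall_realize_iff fun w => ?_⟩
  simp only [Formula.realize_iSup, realize_cell, Subtype.exists, exists_prop, exists_eq_right]
  refine ⟨fun hw => ⟨w, hw, rfl⟩, ?_⟩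
  rintro ⟨v, hv, hvw⟩
  exact h v w (fun δ hδ => Set.ext_iff.1 hvw ⟨δ, hδ⟩) hv

end BooleanCombinations

section FreeVariables

variable {L : FirstOrder.Language.{u, v}} {α : Type w} [DecidableEq α]

theorem realize_iff_of_eqOn_freeVarFinset {M : Type x} [L.Structure M] {l : ℕ}
    {φ : L.BoundedFormula α l} {v w : α → M} {xs : Fin l → M}
    (h : Set.EqOn v w φ.freeVarFinset) : φ.Realize v xs ↔ φ.Realize w xs := by
  have hv := BoundedFormula.realize_restrictFreeVar (φ := φ) (xs := xs) (f := id)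
    (v := fun a => v a) v fun _ => rfl
  have hw := BoundedFormula.realize_restrictFreeVar (φ := φ) (xs := xs) (f := id)
    (v := fun a => v a) w fun a => h a.2
  exact hv.symm.trans hw

theorem card_freeVarFinset_rel_le {l : ℕ} (R : L.Relations l) (g : Fin l → α) :
    (R.formula (Term.var ∘ g) : L.Formula α).freeVarFinset.card ≤ l := by
  have : (R.formula (Term.var ∘ g) : L.Formula α).freeVarFinset = Finset.univ.image g := by
    ext
    simp [Relations.formula, Relations.boundedFormula, BoundedFormula.freeVarFinset,
      Term.varFinsetLeft, eq_comm]
  simpa [this] using Finset.card_image_le (s := Finset.univ) (f := g)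

theorem card_freeVarFinset_equal_le (a b : α) :
    ((Term.var a).equal (Term.var b) : L.Formula α).freeVarFinset.card ≤ 2 := by
  have : ((Term.var a).equal (Term.var b) : L.Formula α).freeVarFinset = {a, b} := by
    ext
    simp [Term.equal, Term.bdEqual, BoundedFormula.freeVarFinset, Term.varFinsetLeft]
  exact this ▸ Finset.card_le_two

end FreeVariables

section RelationalLanguages

variable {L : FirstOrder.Language.{u, v}} {α : Type w} {M : Type x} [L.Structure M]
  {S : Set (Σ l, L.Relations l)}

/-- The set of relation symbols occurring in a formula. -/
def relationSymbols : ∀ {l : ℕ}, L.BoundedFormula α l → Set (Σ l, L.Relations l)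
  | _, .falsum => ∅
  | _, .equal _ _ => ∅
  | _, .rel R _ => {⟨_, R⟩}
  | _, .imp φ ψ => relationSymbols φ ∪ relationSymbols ψ
  | _, .all φ => relationSymbols φ

theorem finite_relationSymbols {l : ℕ} (φ : L.BoundedFormula α l) :
    (relationSymbols φ).Finite := by
  induction φ with
  | falsum | equal => exact Set.finite_empty
  | rel => exact Set.finite_singleton _
  | imp _ _ ihφ ihψ => exact ihφ.union ihψ
  | all _ ih => exact ih

/-- The permutation `σ` is an automorphism of the reduct to the relation symbols in `S`. -/
def PreservesRelations (S : Set (Σ l, L.Relations l)) (σ : Equiv.Perm M) : Prop :=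
  ∀ ⦃l : ℕ⦄ (R : L.Relations l), ⟨l, R⟩ ∈ S → ∀ x : Fin l → M, RelMap R (σ ∘ x) ↔ RelMap R x

theorem PreservesRelations.mono {S' : Set (Σ l, L.Relations l)} {σ : Equiv.Perm M}
    (hσ : PreservesRelations S σ) (hS : S' ⊆ S) : PreservesRelations S' σ :=
  fun _ R hR => hσ R (hS hR)

theorem PreservesRelations.mul {σ τ : Equiv.Perm M} (hσ : PreservesRelations S σ)
    (hτ : PreservesRelations S τ) : PreservesRelations S (σ * τ) :=
  fun _ R hR x => (hσ R hR (τ ∘ x)).trans (hτ R hR x)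

theorem realize_term_comp [L.IsRelational] (σ : M → M) (t : L.Term α) (v : α → M) :
    t.realize (σ ∘ v) = σ (t.realize v) := by
  cases t with
  | var => rfl
  | func f => exact isEmptyElim f

theorem realize_comp_perm_iff [L.IsRelational] {σ : Equiv.Perm M} {l : ℕ}
    {φ : L.BoundedFormula α l} (hσ : PreservesRelations (relationSymbols φ) σ) (v : α → M)
    (xs : Fin l → M) : φ.Realize (σ ∘ v) (σ ∘ xs) ↔ φ.Realize v xs := by
  induction φ with
  | falsum => exact Iff.rfl
  | equal t₁ t₂ =>
    simp only [BoundedFormula.Realize, ← Sum.comp_elim, realize_term_comp, σ.apply_eq_iff_eq]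
  | rel R ts =>
    simp only [BoundedFormula.Realize, ← Sum.comp_elim, realize_term_comp]
    exact hσ R rfl _
  | imp φ ψ ihφ ihψ =>
    rw [BoundedFormula.realize_imp, BoundedFormula.realize_imp,
      ihφ (hσ.mono Set.subset_union_left), ihψ (hσ.mono Set.subset_union_right)]
  | all φ ih =>
    rw [BoundedFormula.realize_all, BoundedFormula.realize_all, ← σ.forall_congr_right]
    refine forall_congr' fun x => ?_
    rw [← ih hσ, Fin.comp_snoc]

theorem realize_formula_comp_perm_iff [L.IsRelational] {σ : Equiv.Perm M} {φ : L.Formula α}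
    (hσ : PreservesRelations (relationSymbols φ) σ) (v : α → M) :
    φ.Realize (σ ∘ v) ↔ φ.Realize v := by
  have h := realize_comp_perm_iff hσ v default
  rwa [Subsingleton.elim (σ ∘ default) default] at h

/-- The equalities between variables, and the formulas `R(x_{g 0}, …, x_{g (l - 1)})` for `R` in
`S`. These are the atomic formulas if there are no function symbols. -/
def atomicFormulas (S : Set (Σ l, L.Relations l)) (α : Type w) : Set (L.Formula α) :=
  (Set.range fun p : α × α => (Term.var p.1).equal (Term.var p.2)) ∪
    ⋃ R ∈ S, Set.range fun g : Fin R.1 → α => R.2.formula (Term.var ∘ g)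

theorem equal_mem_atomicFormulas (a b : α) :
    (Term.var a).equal (Term.var b) ∈ atomicFormulas S α :=
  .inl ⟨(a, b), rfl⟩

theorem rel_mem_atomicFormulas {l : ℕ} {R : L.Relations l} (hR : ⟨l, R⟩ ∈ S) (g : Fin l → α) :
    R.formula (Term.var ∘ g) ∈ atomicFormulas S α :=
  .inr (Set.mem_biUnion hR ⟨g, rfl⟩)

theorem finite_atomicFormulas [Finite α] (hS : S.Finite) : (atomicFormulas S α).Finite :=
  (Set.finite_range _).union (hS.biUnion fun _ _ => Set.finite_range _)

theorem atomicFormulas_mono {S' : Set (Σ l, L.Relations l)} (h : S ⊆ S') :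
    atomicFormulas S α ⊆ atomicFormulas S' α :=
  Set.union_subset_union_right _ (Set.biUnion_subset_biUnion_left h)

theorem AgreeOn.apply_eq_apply_iff {v w : α → M} (h : AgreeOn (atomicFormulas S α) v w)
    (a b : α) : v a = v b ↔ w a = w b := by
  simpa only [Formula.realize_equal, Term.realize_var] using h _ (equal_mem_atomicFormulas a b)

theorem AgreeOn.relMap_comp_iff {v w : α → M} (h : AgreeOn (atomicFormulas S α) v w) {l : ℕ}
    {R : L.Relations l} (hR : ⟨l, R⟩ ∈ S) (g : Fin l → α) :
    RelMap R (v ∘ g) ↔ RelMap R (w ∘ g) := by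
  have h := h _ (rel_mem_atomicFormulas hR g)
  rwa [Formula.realize_rel, Formula.realize_rel] at h

/-- Quantifier elimination, from the homogeneity of arbitrarily large finite reducts. -/
theorem isBasedOn_atomicFormulas [L.IsRelational] [Finite α]
    (hM : ∀ S : Set (Σ l, L.Relations l), S.Finite → ∃ S' ⊇ S, S'.Finite ∧
      ∀ v w : α → M, AgreeOn (atomicFormulas S' α) v w →
        ∃ σ : Equiv.Perm M, PreservesRelations S' σ ∧ σ ∘ v = w)
    (φ : L.Formula α) : IsBasedOn (L.completeTheory M) (atomicFormulas Set.univ α) φ := by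
  obtain ⟨S, hφS, hS, hconj⟩ := hM _ (finite_relationSymbols φ)
  refine (isBasedOn_completeTheory_of_finite (finite_atomicFormulas hS) fun v w hvw hv => ?_).mono
    (atomicFormulas_mono S.subset_univ)
  obtain ⟨σ, hσ, rfl⟩ := hconj v w hvw
  exact (realize_formula_comp_perm_iff (hσ.mono hφS) v).2 hv

end RelationalLanguages

section AlmostArity

variable {L : FirstOrder.Language.{u, v}} {T : L.Theory} {n k : ℕ}

theorem isNFormula_of_card_le {φ : L.Formula (Fin k)} (h : φ.freeVarFinset.card ≤ n) :
    IsNFormula T n φ :=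
  .of_mem h

theorem isAlmostNAry_of_finite_family {β : Type*} [Finite β] {r : β → ℕ}
    (Φ : ∀ b, L.Formula (Fin (r b)))
    (h : ∀ (k : ℕ) (φ : L.Formula (Fin k)),
      IsBasedOn T ({ψ | IsNFormula T n ψ} ∪ {χ | ∃ b f, χ = (Φ b).relabel f}) φ) :
    IsAlmostNAry T n := by
  obtain ⟨s, hs⟩ := (Set.finite_range r).bddAbove
  have hrs (b : β) : r b ≤ s := hs ⟨b, rfl⟩
  refine ⟨s, Set.range fun b => (Φ b).relabel (Fin.castLE (hrs b)), Set.finite_range _, ?_⟩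
  rintro (_ | k) φ
  · exact .of_mem (.inl (isNFormula_of_card_le (by simp [Finset.eq_empty_of_isEmpty])))
  · refine (h _ φ).trans ?_
    rintro _ (hψ | ⟨b, f, rfl⟩)
    · exact .of_mem (.inl hψ)
    · let f' : Fin s → Fin (k + 1) := Function.extend (Fin.castLE (hrs b)) f 0
      have hf' : f' ∘ Fin.castLE (hrs b) = f := Function.extend_comp (Fin.castLE_injective _) f 0
      refine ⟨_, .of (.inr ⟨_, ⟨b, rfl⟩, f', rfl⟩), Theory.models_formula_iff.2 fun N v => ?_⟩
      rw [Formula.realize_iff, Formula.realize_relabel, Formula.realize_relabel,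
        Formula.realize_relabel, Function.comp_assoc, hf']

theorem sInf_natCast_eq_of_isLeast {P : ℕ → Prop} (h : IsLeast {k | P k} n) :
    sInf {N : ℕ∞ | ∃ k : ℕ, P k ∧ N = k} = n := by
  refine IsLeast.csInf_eq ⟨⟨n, h.1, rfl⟩, ?_⟩
  rintro _ ⟨k, hk, rfl⟩
  exact Nat.cast_le.2 (h.2 hk)

end AlmostArity

section Combinatorics

theorem exists_perm_fixing_comp_eq {X α : Type*} [Finite α] {A : Set X} {v w : α → X}
    (hvw : ∀ a b, v a = v b ↔ w a = w b) (hA : ∀ a, v a ∈ A ∨ w a ∈ A → v a = w a) :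
    ∃ σ : Equiv.Perm X, (∀ x ∈ A, σ x = x) ∧ σ ∘ v = w := by
  classical
  let v' : {a // v a ∉ A} → {x // x ∉ A} := fun a => ⟨v a, a.2⟩
  let w' : {a // v a ∉ A} → {x // x ∉ A} := fun a =>
    ⟨w a, fun h => a.2 (by rwa [hA a (.inr h)])⟩
  have hvw' (a b) : v' a = v' b ↔ w' a = w' b := by simpa [v', w'] using hvw a b
  obtain ⟨τ, hτ⟩ := Equiv.Perm.exists_extending_pair (Subtype.val : Set.range v' → _)
    (w' ∘ Set.rangeSplitting v') Subtype.val_injective fun y z hyz => Subtype.ext <| by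
      rw [← Set.apply_rangeSplitting v' y, ← Set.apply_rangeSplitting v' z, hvw']
      exact hyz
  have hτv (a) : τ (v' a) = w' a := by
    have h := Set.apply_rangeSplitting v' ⟨v' a, Set.mem_range_self a⟩
    exact (hτ ⟨v' a, Set.mem_range_self a⟩).trans ((hvw' _ _).1 h)
  refine ⟨Equiv.Perm.ofSubtype τ, fun x hx =>
    Equiv.Perm.ofSubtype_apply_of_not_mem τ (not_not_intro hx), funext fun a => ?_⟩
  by_cases ha : v a ∈ A
  · rw [Function.comp_apply, Equiv.Perm.ofSubtype_apply_of_not_mem τ (not_not_intro ha),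
      hA a (.inl ha)]
  · rw [Function.comp_apply, Equiv.Perm.ofSubtype_apply_of_mem τ ha]
    exact congrArg Subtype.val (hτv ⟨a, ha⟩)

theorem exists_sum_eq_forall_ne_eq {β G : Type*} [Fintype β] [AddCommGroup G] (s : β → G)
    (b₀ : β) (t : G) : ∃ f : β → G, ∑ b, f b = t ∧ ∀ b ≠ b₀, f b = s b := by
  classical
  refine ⟨Function.update s b₀ (s b₀ + (t - ∑ b, s b)), ?_, fun b hb => by simp [hb]⟩
  rw [Finset.sum_update_of_mem (Finset.mem_univ _), Finset.sdiff_singleton_eq_erase,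
    add_right_comm, Finset.add_sum_erase _ s (Finset.mem_univ b₀), add_sub_cancel]

end Combinatorics

section ParityStructure

/-- The relation symbols of the parity structure: a unary predicate for each column, and for each
index `i` a parity relation of arity `d i`. -/
inductive ParityRel {ι : Type u} (d : ι → ℕ) : ℕ → Type u
  | column (c : Σ i, Fin (d i)) : ParityRel d 1
  | parity (i : ι) : ParityRel d (d i)

/-- The relational language of the parity structure. -/
def parityLang {ι : Type u} (d : ι → ℕ) : FirstOrder.Language.{0, u} where
  Functions _ := Empty
  Relations := ParityRel d

variable {ι : Type u} {d : ι → ℕ}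

instance : (parityLang d).IsRelational := fun _ => inferInstanceAs (IsEmpty Empty)

/-- The index of a column symbol or of a parity symbol. -/
def ParityRel.index {l : ℕ} : ParityRel d l → ι
  | .column c => c.1
  | .parity i => i

/-- The relation symbols with index in `I`. -/
def symbolsOver (d : ι → ℕ) (I : Set ι) : Set (Σ l, (parityLang d).Relations l) :=
  {R | ParityRel.index R.2 ∈ I}

theorem finite_symbolsOver {I : Set ι} (hI : I.Finite) : (symbolsOver d I).Finite := by
  refine (hI.biUnion fun i _ => (Set.finite_range fun j : Fin (d i) =>
    (⟨1, .column ⟨i, j⟩⟩ : Σ l, ParityRel d l)).insert ⟨d i, .parity i⟩).subset ?_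
  rintro ⟨_, ⟨i, j⟩ | i⟩ hi
  · exact Set.mem_biUnion hi (.inr ⟨j, rfl⟩)
  · exact Set.mem_biUnion hi (.inl rfl)

/-- The carrier of the parity structure: each column consists of one point of each parity. -/
abbrev Point (d : ι → ℕ) : Type u := (Σ i, Fin (d i)) × ZMod 2

/-- The tuple runs through the columns of index `i` in their order. -/
def IsTransversal (i : ι) (x : Fin (d i) → Point d) : Prop :=
  ∀ j, (x j).1 = ⟨i, j⟩

instance : (parityLang d).Structure (Point d) where
  funMap f := f.elim
  RelMap {_} R := match R with
    | .column c => fun x => (x 0).1 = c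
    | .parity i => fun x => IsTransversal i x ∧ ∑ j, (x j).2 = 0

/-- The complete theory of the parity structure. -/
abbrev parityTheory (d : ι → ℕ) : (parityLang d).Theory :=
  (parityLang d).completeTheory (Point d)

theorem relMap_column {c : Σ i, Fin (d i)} {x : Fin 1 → Point d} :
    RelMap (L := parityLang d) (ParityRel.column c) x ↔ (x 0).1 = c :=
  Iff.rfl

theorem relMap_parity {i : ι} {x : Fin (d i) → Point d} :
    RelMap (L := parityLang d) (ParityRel.parity i) x ↔ IsTransversal i x ∧ ∑ j, (x j).2 = 0 :=
  Iff.rfl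

/-- The permutation shifting the parities in each column by a constant. -/
def shift (f : ∀ i, Fin (d i) → ZMod 2) : Equiv.Perm (Point d) :=
  Equiv.prodShear (Equiv.refl _) fun c => Equiv.addRight (f c.1 c.2)

theorem shift_apply (f : ∀ i, Fin (d i) → ZMod 2) (x : Point d) :
    shift f x = (x.1, x.2 + f x.1.1 x.1.2) :=
  rfl

theorem preservesRelations_shift {S : Set (Σ l, (parityLang d).Relations l)}
    {f : ∀ i, Fin (d i) → ZMod 2} (hf : ∀ R ∈ S, ∑ j, f (ParityRel.index R.2) j = 0) :
    PreservesRelations S (shift f) := by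
  rintro _ (c | i) hR x
  · exact Iff.rfl
  · refine and_congr_right fun hx : IsTransversal i x => ?_
    have hshift (j) : ((shift f ∘ x) j).2 = (x j).2 + f i j := by
      rw [Function.comp_apply, shift_apply, hx j]
    have hsum : ∑ j, f i j = 0 := hf _ hR
    simp only [hshift, Finset.sum_add_distrib, hsum, add_zero]

theorem preservesRelations_of_forall_fixed {I : Set ι} {σ : Equiv.Perm (Point d)}
    (hσ : ∀ x : Point d, x.1.1 ∈ I → σ x = x) : PreservesRelations (symbolsOver d I) σ := by
  have comp_eq {l : ℕ} {R : (parityLang d).Relations l} (hR : ParityRel.index R ∈ I)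
      {x : Fin l → Point d} (hx : RelMap R x) : σ ∘ x = x := by
    refine funext fun j => hσ _ ?_
    cases R with
    | column c => exact Subsingleton.elim 0 j ▸ relMap_column.1 hx ▸ hR
    | parity i => exact (relMap_parity.1 hx).1 j ▸ hR
  refine fun l R hR x => ⟨fun hx => ?_, fun hx => (comp_eq hR hx).symm ▸ hx⟩
  exact σ.injective.comp_left (comp_eq hR hx) ▸ hx

theorem exists_column_shift {α : Type*} {v w : α → Point d} {c : Σ i, Fin (d i)}
    (hcol : ∀ a, (v a).1 = c ↔ (w a).1 = c) (heq : ∀ a b, v a = v b ↔ w a = w b) :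
    ∃ s : ZMod 2, ∀ a, (v a).1 = c → (w a).2 = (v a).2 + s := by
  by_cases h : ∃ a, (v a).1 = c
  · obtain ⟨a, ha⟩ := h
    have eq_add_sub : ∀ p p' q q' : ZMod 2, (p = p' ↔ q = q') → q' = p' + (q - p) := by decide
    refine ⟨(w a).2 - (v a).2, fun b hb => eq_add_sub _ _ _ _ ?_⟩
    simpa only [Prod.ext_iff, ha, hb, (hcol a).1 ha, (hcol b).1 hb, true_and] using heq a b
  · exact ⟨0, fun a ha => (h ⟨a, ha⟩).elim⟩

theorem exists_zero_sum_shift {α : Type*} {v w : α → Point d} {i : ι}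
    (hcol : ∀ j a, (v a).1 = ⟨i, j⟩ ↔ (w a).1 = ⟨i, j⟩)
    (hpar : ∀ g : Fin (d i) → α, RelMap (L := parityLang d) (ParityRel.parity i) (v ∘ g) ↔
      RelMap (L := parityLang d) (ParityRel.parity i) (w ∘ g))
    (heq : ∀ a b, v a = v b ↔ w a = w b) :
    ∃ f : Fin (d i) → ZMod 2, ∑ j, f j = 0 ∧
      ∀ j a, (v a).1 = ⟨i, j⟩ → (w a).2 = (v a).2 + f j := by
  choose s hs using fun j => exists_column_shift (hcol j) heq
  by_cases hmeet : ∀ j, ∃ a, (v a).1 = ⟨i, j⟩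
  · choose g hg using hmeet
    refine ⟨s, ?_, hs⟩
    have hv : IsTransversal i (v ∘ g) := hg
    have hw : IsTransversal i (w ∘ g) := fun j => (hcol j (g j)).1 (hg j)
    have hsum : ∑ j, ((w ∘ g) j).2 = ∑ j, ((v ∘ g) j).2 + ∑ j, s j := by
      rw [← Finset.sum_add_distrib]
      exact Finset.sum_congr rfl fun j _ => hs j (g j) (hg j)
    have heven := hpar g
    simp only [relMap_parity, hv, hw, hsum, true_and] at heven
    have eq_zero : ∀ p q : ZMod 2, (p = 0 ↔ p + q = 0) → q = 0 := by decide
    exact eq_zero _ _ heven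
  · push Not at hmeet
    obtain ⟨j₀, hj₀⟩ := hmeet
    obtain ⟨f, hf, hfs⟩ := exists_sum_eq_forall_ne_eq s j₀ 0
    refine ⟨f, hf, fun j a ha => ?_⟩
    have hj : j ≠ j₀ := by
      rintro rfl
      exact hj₀ a ha
    rw [hfs j hj, hs j a ha]

theorem exists_perm_of_agreeOn {α : Type*} [Finite α] {I : Set ι} {v w : α → Point d}
    (h : AgreeOn (atomicFormulas (symbolsOver d I) α) v w) :
    ∃ σ : Equiv.Perm (Point d), PreservesRelations (symbolsOver d I) σ ∧ σ ∘ v = w := by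
  classical
  have hcol (c : Σ i, Fin (d i)) (hc : c.1 ∈ I) (a : α) : (v a).1 = c ↔ (w a).1 = c :=
    h.relMap_comp_iff (R := ParityRel.column c) hc fun _ => a
  have hf (i : ι) : ∃ f : Fin (d i) → ZMod 2, i ∈ I → ∑ j, f j = 0 ∧
      ∀ j a, (v a).1 = ⟨i, j⟩ → (w a).2 = (v a).2 + f j := by
    by_cases hi : i ∈ I
    · obtain ⟨f, hf⟩ := exists_zero_sum_shift (fun j => hcol ⟨i, j⟩ hi)
        (h.relMap_comp_iff (R := ParityRel.parity i) hi) h.apply_eq_apply_iff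
      exact ⟨f, fun _ => hf⟩
    · exact ⟨0, fun hi' => (hi hi').elim⟩
  choose f hf using hf
  have hshift (a : α) (ha : (v a).1.1 ∈ I) : shift f (v a) = w a :=
    Prod.ext ((hcol _ ha a).1 rfl).symm ((hf _ ha).2 _ a rfl).symm
  obtain ⟨σ, hσ, hσv⟩ := exists_perm_fixing_comp_eq (A := {x : Point d | x.1.1 ∈ I})
    (v := shift f ∘ v) (w := w) (fun a b => by simpa using h.apply_eq_apply_iff a b) <| by
      rintro a (ha | ha)
      · exact hshift a ha
      · exact hshift a (by rwa [(hcol _ ha a).2 rfl])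
  exact ⟨σ * shift f, (preservesRelations_of_forall_fixed hσ).mul
    (preservesRelations_shift fun R hR => (hf _ hR).1), hσv⟩

theorem isBasedOn_atomicFormulas_parityTheory {α : Type*} [Finite α]
    (φ : (parityLang d).Formula α) :
    IsBasedOn (parityTheory d) (atomicFormulas Set.univ α) φ :=
  isBasedOn_atomicFormulas (fun S hS =>
    ⟨symbolsOver d ((fun R => ParityRel.index R.2) '' S), fun _ hR => Set.mem_image_of_mem _ hR,
      finite_symbolsOver (hS.image _), fun _ _ => exists_perm_of_agreeOn⟩) φ

theorem IsTransversal.injective {i : ι} {x : Fin (d i) → Point d} (hx : IsTransversal i x) :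
    Function.Injective x := by
  intro j k hjk
  simpa [hx j, hx k] using congrArg Prod.fst hjk

theorem IsTransversal.exists_perm_comp_eq {i : ι} {x y : Fin (d i) → Point d}
    (hx : IsTransversal i x) (hy : IsTransversal i y)
    {S : Set (Σ l, (parityLang d).Relations l)}
    (hS : ∀ R ∈ S, ParityRel.index R.2 = i → ∑ j, (x j).2 = ∑ j, (y j).2) :
    ∃ σ : Equiv.Perm (Point d), PreservesRelations S σ ∧ σ ∘ x = y := by
  classical
  let f : ∀ i, Fin (d i) → ZMod 2 := Pi.single i fun j => (y j).2 - (x j).2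
  have hfi : f i = fun j => (y j).2 - (x j).2 := Pi.single_eq_same _ _
  refine ⟨shift f, preservesRelations_shift fun R hR => ?_, funext fun j => ?_⟩
  · by_cases hRi : ParityRel.index R.2 = i
    · rw [hRi, hfi, Finset.sum_sub_distrib, hS R hR hRi, sub_self]
    · simp [f, hRi]
  · rw [Function.comp_apply, shift_apply, hx j]
    exact Prod.ext (hy j).symm (by simp [hfi])

theorem IsTransversal.agreeOn_formulasOfArity {i : ι} {n : ℕ} (hn : n < d i)
    {x y : Fin (d i) → Point d} (hx : IsTransversal i x) (hy : IsTransversal i y) :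
    AgreeOn (formulasOfArity (parityLang d) n (d i)) x y := by
  intro φ (hφ : φ.freeVarFinset.card ≤ n)
  obtain ⟨j₀, hj₀⟩ : ∃ j₀, j₀ ∉ φ.freeVarFinset := by
    by_contra! hall
    have := Finset.card_eq_iff_eq_univ φ.freeVarFinset |>.2 (Finset.eq_univ_iff_forall.2 hall)
    rw [Fintype.card_fin] at this
    omega
  obtain ⟨s, hs, hsx⟩ := exists_sum_eq_forall_ne_eq (fun j => (x j).2) j₀ (∑ j, (y j).2)
  let x' : Fin (d i) → Point d := fun j => ((x j).1, s j)
  have hxx' : Set.EqOn x x' φ.freeVarFinset := fun j hj =>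
    Prod.ext rfl (hsx j (ne_of_mem_of_not_mem hj hj₀)).symm
  have hx' : IsTransversal i x' := hx
  obtain ⟨σ, hσ, rfl⟩ := hx'.exists_perm_comp_eq hy (S := relationSymbols φ) fun _ _ _ => hs
  exact (realize_iff_of_eqOn_freeVarFinset hxx').trans (realize_formula_comp_perm_iff hσ x').symm

theorem IsTransversal.agreeOn_setOf_isNFormula {i : ι} {n : ℕ} (hn : n < d i)
    {x y : Fin (d i) → Point d} (hx : IsTransversal i x) (hy : IsTransversal i y) :
    AgreeOn {φ : (parityLang d).Formula (Fin (d i)) | IsNFormula (parityTheory d) n φ} x y := by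
  have : Nonempty (Point d) := ⟨x ⟨n, hn⟩⟩
  exact fun φ hφ => (hx.agreeOn_formulasOfArity hn hy).realize_iff_of_isBasedOn hφ

theorem IsTransversal.agreeOn_equalities {i : ι} {x y : Fin (d i) → Point d}
    (hx : IsTransversal i x) (hy : IsTransversal i y) :
    AgreeOn (equalities (parityLang d) (d i)) x y := by
  rintro _ ⟨j, k, rfl⟩
  simp only [Formula.realize_equal, Term.realize_var, hx.injective.eq_iff, hy.injective.eq_iff]

theorem IsTransversal.agreeOn_substitutions {i : ι} {r : ℕ}
    {Φ : Set ((parityLang d).Formula (Fin r))}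
    (hΦ : ∀ φ ∈ Φ, ∀ R ∈ relationSymbols φ, ParityRel.index R.2 ≠ i)
    {x y : Fin (d i) → Point d} (hx : IsTransversal i x) (hy : IsTransversal i y) :
    AgreeOn (substitutions Φ (d i)) x y := by
  rintro _ ⟨φ, hφ, f, rfl⟩
  obtain ⟨σ, hσ, rfl⟩ := hx.exists_perm_comp_eq hy fun R hR hRi => (hΦ φ hφ R hR hRi).elim
  rw [Formula.realize_relabel, Formula.realize_relabel, Function.comp_assoc,
    realize_formula_comp_perm_iff hσ]

/-- The parity relation of index `i` as a formula. -/
def parityFormula (d : ι → ℕ) (i : ι) : (parityLang d).Formula (Fin (d i)) :=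
  Relations.formula (L := parityLang d) (ParityRel.parity i) Term.var

theorem realize_parityFormula {i : ι} {x : Fin (d i) → Point d} :
    (parityFormula d i).Realize x ↔ IsTransversal i x ∧ ∑ j, (x j).2 = 0 :=
  Formula.realize_rel

theorem not_isBasedOn_parityFormula {i : ι} (hi : 0 < d i)
    {Δ : Set ((parityLang d).Formula (Fin (d i)))}
    (hΔ : ∀ x y : Fin (d i) → Point d, IsTransversal i x → IsTransversal i y → AgreeOn Δ x y) :
    ¬ IsBasedOn (parityTheory d) Δ (parityFormula d i) := by
  intro h
  have exists_transversal (t : ZMod 2) :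
      ∃ x : Fin (d i) → Point d, IsTransversal i x ∧ ∑ j, (x j).2 = t := by
    obtain ⟨s, hs, -⟩ := exists_sum_eq_forall_ne_eq 0 (⟨0, hi⟩ : Fin (d i)) t
    exact ⟨fun j => (⟨i, j⟩, s j), fun _ => rfl, hs⟩
  obtain ⟨x, hx, hx_even⟩ := exists_transversal 0
  obtain ⟨y, hy, hy_odd⟩ := exists_transversal 1
  have : Nonempty (Point d) := ⟨x ⟨0, hi⟩⟩
  have hxy := (hΔ x y hx hy).realize_iff_of_isBasedOn h
  simp [realize_parityFormula, hx, hy, hx_even, hy_odd] at hxy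

theorem ParityRel.arity_le_of_forall_le {n l : ℕ} (hn : 1 ≤ n) (hd : ∀ i, d i ≤ n)
    (R : ParityRel d l) : l ≤ n := by
  cases R with
  | column => exact hn
  | parity i => exact hd i

theorem isNAry_parityTheory {n : ℕ} (hn : 1 ≤ n) (hd : ∀ i, d i ≤ n) :
    IsNAry (parityTheory d) n := by
  have hrel {k l : ℕ} (R : (parityLang d).Relations l) (g : Fin l → Fin k) :
      R.formula (Term.var ∘ g) ∈ formulasOfArity (parityLang d) n k :=
    (card_freeVarFinset_rel_le R g).trans (R.arity_le_of_forall_le hn hd)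
  unfold IsNAry
  split_ifs with hn1
  · subst hn1
    refine fun k φ => (isBasedOn_atomicFormulas_parityTheory φ).mono ?_
    rintro _ (⟨⟨a, b⟩, rfl⟩ | hδ)
    · exact .inr ⟨a, b, rfl⟩
    · obtain ⟨R, -, g, rfl⟩ := Set.mem_iUnion₂.1 hδ
      exact .inl (hrel R.2 g)
  · refine fun k φ => (isBasedOn_atomicFormulas_parityTheory φ).mono ?_
    rintro _ (⟨⟨a, b⟩, rfl⟩ | hδ)
    · exact (card_freeVarFinset_equal_le a b).trans (by omega)
    · obtain ⟨R, -, g, rfl⟩ := Set.mem_iUnion₂.1 hδ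
      exact hrel R.2 g

theorem le_of_isNAry_parityTheory {n : ℕ} (h : IsNAry (parityTheory d) n) (i : ι) : d i ≤ n := by
  by_contra! hi
  refine not_isBasedOn_parityFormula (i := i) (by omega)
    (fun x y hx hy => (hx.agreeOn_formulasOfArity hi hy).union (hx.agreeOn_equalities hy)) ?_
  unfold IsNAry at h
  split_ifs at h with hn1
  · subst hn1
    exact h _ _
  · exact IsBasedOn.mono (h _ _) Set.subset_union_left

theorem isAlmostNAry_parityTheory {n : ℕ} (hn : 1 ≤ n) (hd : {i | n < d i}.Finite) :
    IsAlmostNAry (parityTheory d) n := by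
  have : Finite {i // n < d i} := hd.to_subtype
  let r : Option {i // n < d i} → ℕ := fun o => o.elim 2 fun i => d i
  -- The case `none` is needed for `n = 1`, as equality is not a `1`-formula.
  let Φ : ∀ o, (parityLang d).Formula (Fin (r o))
    | none => (Term.var (0 : Fin 2)).equal (Term.var 1)
    | some i => parityFormula d i
  refine isAlmostNAry_of_finite_family Φ fun k φ =>
    (isBasedOn_atomicFormulas_parityTheory φ).mono ?_
  rintro _ (⟨⟨a, b⟩, rfl⟩ | hδ)
  · exact .inr ⟨none, ![a, b], rfl⟩
  · obtain ⟨⟨l, R⟩, -, g, rfl⟩ := Set.mem_iUnion₂.1 hδ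
    by_cases hl : l ≤ n
    · exact .inl (isNFormula_of_card_le ((card_freeVarFinset_rel_le R g).trans hl))
    · cases R with
      | column => exact (hl hn).elim
      | parity i => exact .inr ⟨some ⟨i, not_le.1 hl⟩, g, rfl⟩

theorem finite_of_isAlmostNAry_parityTheory {n : ℕ} (h : IsAlmostNAry (parityTheory d) n) :
    {i | n < d i}.Finite := by
  obtain ⟨r, Φ, hΦ, h⟩ := h
  let I : Set ι := ⋃ φ ∈ Φ, (fun R => ParityRel.index R.2) '' relationSymbols φ
  have hI : I.Finite := hΦ.biUnion fun φ _ => (finite_relationSymbols φ).image _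
  refine hI.subset fun i (hi : n < d i) => ?_
  by_contra hiI
  have hΦi : ∀ φ ∈ Φ, ∀ R ∈ relationSymbols φ, ParityRel.index R.2 ≠ i := by
    rintro φ hφ R hR rfl
    exact hiI (Set.mem_biUnion hφ ⟨R, hR, rfl⟩)
  exact not_isBasedOn_parityFormula (by omega)
    (fun x y hx hy => (hx.agreeOn_setOf_isNFormula hi hy).union (hx.agreeOn_substitutions hΦi hy))
    (h _ _)

theorem ar_parityTheory {n : ℕ} (hn : 1 ≤ n) (h : IsGreatest (Set.range d) n) :
    ar (parityTheory d) = n := by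
  obtain ⟨⟨i, rfl⟩, hd⟩ := h
  exact sInf_natCast_eq_of_isLeast
    ⟨isNAry_parityTheory hn fun i => hd ⟨i, rfl⟩, fun _ hk => le_of_isNAry_parityTheory hk i⟩

theorem aar_parityTheory {m : ℕ} (hm : 1 ≤ m) (hfin : {i | m < d i}.Finite)
    (hinf : {i | m ≤ d i}.Infinite) : aar (parityTheory d) = m := by
  refine sInf_natCast_eq_of_isLeast ⟨isAlmostNAry_parityTheory hm hfin, fun k hk => ?_⟩
  by_contra! hkm
  exact hinf ((finite_of_isAlmostNAry_parityTheory hk).subset fun i hi => hkm.trans_le hi)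

end ParityStructure

end ArityOfTheories

theorem mainTheorem3 (m n : ℕ) (hm : 1 ≤ m) (hmn : m ≤ n) :
    ∃ (L : FirstOrder.Language.{0, 0}) (T : L.Theory), T.IsComplete ∧
      ArityOfTheories.aar T = m ∧ ArityOfTheories.ar T = n := by
  let d : Option ℕ → ℕ := fun i => i.elim n fun _ => m
  have : Nonempty (ArityOfTheories.Point d) := ⟨⟨⟨none, ⟨0, hm.trans hmn⟩⟩, 0⟩⟩
  have hfin : {i | m < d i}.Finite := (Set.finite_singleton none).subset <| by
    rintro (_ | k) hi
    exacts [rfl, (lt_irrefl m hi).elim]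
  have hinf : {i | m ≤ d i}.Infinite :=
    Set.infinite_of_injective_forall_mem (Option.some_injective ℕ) fun _ => le_refl m
  have hmax : IsGreatest (Set.range d) n := by
    refine ⟨⟨none, rfl⟩, ?_⟩
    rintro _ ⟨_ | k, rfl⟩
    exacts [le_refl n, hmn]
  exact ⟨_, ArityOfTheories.parityTheory d,
    FirstOrder.Language.completeTheory.isComplete _ _,
    ArityOfTheories.aar_parityTheory hm hfin hinf,
    ArityOfTheories.ar_parityTheory (hm.trans hmn) hmax⟩
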